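/- Let $\mathcal H$ be an infinite-dimensional complex Hilbert space, let $A$ be a bounded normal operator on $\mathcal H$, and let $\mathcal G\subset\mathcal H$ be a finite set with $|\mathcal G|$ elements. Suppose that $\{e^{tA}g\}_{g\in\mathcal G,\,t\in[0,\infty)}$, where $e^{tA}=\sum_{n\ge 0}\frac{t^n}{n!}A^n$, is a semi-continuous frame for $\mathcal H$, i.e. there are constants $c,C>0$ such that $$c\|f\|^2\le\sum_{g\in\mathcal G}\int_0^\infty|\langle f,e^{tA}g\rangle|^2\,dt\le C\|f\|^2\qquad\text{for all } f\in\mathcal H.$$ Then there are pairwise distinct complex numbers $\lambda_j$ $(j\in\mathbb N)$ and non-zero, mutually orthogonal orthogonal projections $P_j$ on $\mathcal H$ such that $\sum_j P_j=I$ and $$A=\sum_j-\lambda_jP_j,\qquad \operatorname{rank}P_j\le|\mathcal G|\quad\text{for all } j,$$ where both series converge (unconditionally) in the strong operator topology. In particular, every eigenvalue of $A$ has multiplicity at most $|\mathcal G|$, i.e. $\dim\ker(A-zI)\le|\mathcal G|$ for all $z\in\mathbb C$. -/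

import Mathlib

open MeasureTheory
open scoped ENNReal

/-- The system `{e^{tA} g}`, `g ∈ G`, `t ∈ T`, is a semi-continuous frame for `H`: there are
constants `c, C > 0` such that for all `f`
`c ‖f‖² ≤ ∑_{g ∈ G} ∫_T |⟪f, e^{tA} g⟫|² dt ≤ C ‖f‖²`,
where `e^{tA}` is the exponential series of the bounded operator `t A` and `dt` is the Lebesgue
measure. Sum and integral are taken in `[0, ∞]`. -/
def IsSemicontinuousFrame {H : Type*} [NormedAddCommGroup H] [InnerProductSpace ℂ H]
    [CompleteSpace H] (A : H →L[ℂ] H) (G : Set H) (T : Set ℝ) : Prop :=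
  ∃ c C : ℝ, 0 < c ∧ 0 < C ∧ ∀ f : H,
    ENNReal.ofReal (c * ‖f‖ ^ 2) ≤
        ∑' g : G, ∫⁻ t in T,
          ENNReal.ofReal (‖inner ℂ f (NormedSpace.exp ((t : ℂ) • A) (g : H))‖ ^ 2) ∧
      ∑' g : G, ∫⁻ t in T,
          ENNReal.ofReal (‖inner ℂ f (NormedSpace.exp ((t : ℂ) • A) (g : H))‖ ^ 2) ≤
        ENNReal.ofReal (C * ‖f‖ ^ 2)

/-! Differentiating `|⟪f, e^{tA} g⟫|²` and integrating over `[0, ∞)` gives a Lyapunov identity with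
boundary term `-|⟪f, g⟫|²`. For `f` orthogonal to all generators this term vanishes, and the frame
bounds give `|Re z| √(c/C) ‖f‖ ≤ ‖A†f - z̄ f‖` (`IsOrbitFrame.norm_sq_le`). By normality `A - z` is
then bounded below on a closed subspace of finite codimension if `Re z ≠ 0`, so it is invertible
once injective: spectrum off the imaginary axis consists of eigenvalues. If the whole spectrum is
imaginary, `e^{tA}` is unitary and the vanishing tails of the frame integrals force the space to be
zero.

So a nonzero space carrying such a frame contains an eigenvector. The frame property passes to
reducing subspaces, hence the orthogonal complement of all eigenspaces is zero. Pairing with the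
generators is injective on each eigenspace, which bounds its dimension. -/

/-! ### Orbit coefficients, the Lyapunov identity and its consequences -/

section Orbit

variable {H : Type*} [NormedAddCommGroup H] [InnerProductSpace ℂ H] [CompleteSpace H]
  {ι : Type*} [Fintype ι]

/-- The squared modulus of the coefficient of `f` at the orbit point `e^{tA} g`. -/
noncomputable def orbitCoeffSq (A : H →L[ℂ] H) (g f : H) (t : ℝ) : ℝ :=
  ‖inner ℂ f (NormedSpace.exp ((t : ℂ) • A) g)‖ ^ 2

/-- The family `{e^{tA} (g i)}`, `t ≥ 0`, is a semi-continuous frame with bounds `c` and `C`,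
expressed with integrable functions and real integrals. -/
structure IsOrbitFrame (A : H →L[ℂ] H) (g : ι → H) (c C : ℝ) : Prop where
  lower_pos : 0 < c
  integrableOn : ∀ f i, IntegrableOn (orbitCoeffSq A (g i) f) (Set.Ioi 0)
  lower : ∀ f, c * ‖f‖ ^ 2 ≤ ∑ i, ∫ t in Set.Ioi 0, orbitCoeffSq A (g i) f t
  upper : ∀ f, ∑ i, ∫ t in Set.Ioi 0, orbitCoeffSq A (g i) f t ≤ C * ‖f‖ ^ 2

theorem hasDerivAt_inner_exp_smul (A : H →L[ℂ] H) (g f : H) (t : ℝ) :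
    HasDerivAt (fun s : ℝ => inner ℂ f (NormedSpace.exp ((s : ℂ) • A) g))
      (inner ℂ (A.adjoint f) (NormedSpace.exp ((t : ℂ) • A) g)) t := by
  have h := (hasDerivAt_exp_smul_const' (𝕂 := ℂ) A (t : ℂ)).scomp t Complex.ofRealCLM.hasDerivAt
  rw [Complex.ofRealCLM_apply, Complex.ofReal_one, one_smul] at h
  let T : (H →L[ℂ] H) →L[ℂ] ℂ := (innerSL ℂ f).comp (ContinuousLinearMap.apply ℂ H g)
  have h2 := (T.restrictScalars ℝ).hasFDerivAt.comp_hasDerivAt t h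
  rw [ContinuousLinearMap.adjoint_inner_left]
  exact h2

theorem continuous_inner_exp_smul (A : H →L[ℂ] H) (g f : H) :
    Continuous (fun s : ℝ => inner ℂ f (NormedSpace.exp ((s : ℂ) • A) g)) :=
  continuous_iff_continuousAt.2 fun t => (hasDerivAt_inner_exp_smul A g f t).continuousAt

theorem continuous_orbitCoeffSq (A : H →L[ℂ] H) (g f : H) : Continuous (orbitCoeffSq A g f) :=
  (continuous_inner_exp_smul A g f).norm.pow 2

theorem orbitCoeffSq_nonneg (A : H →L[ℂ] H) (g f : H) (t : ℝ) : 0 ≤ orbitCoeffSq A g f t :=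
  sq_nonneg _

/-- Young's inequality; taking `ε = |Re z|` later lets half of a main term `2|Re z|∫` absorb the
cross term. -/
theorem abs_two_mul_real_inner_le {ε : ℝ} (hε : 0 < ε) (u v : ℂ) :
    |2 * inner ℝ u v| ≤ ε * ‖u‖ ^ 2 + ε⁻¹ * ‖v‖ ^ 2 := by
  have h := abs_real_inner_le_norm u v
  have h2 : 0 ≤ ε⁻¹ * (ε * ‖u‖ - ‖v‖) ^ 2 := by positivity
  have h3 : ε⁻¹ * (ε * ‖u‖ - ‖v‖) ^ 2 = ε * ‖u‖ ^ 2 + ε⁻¹ * ‖v‖ ^ 2 - 2 * (‖u‖ * ‖v‖) := by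
    field_simp
    ring
  rw [abs_mul, abs_two]
  linarith

theorem integrableOn_two_mul_inner_orbit (A : H →L[ℂ] H) (g f h : H)
    (hf : IntegrableOn (orbitCoeffSq A g f) (Set.Ioi 0))
    (hh : IntegrableOn (orbitCoeffSq A g h) (Set.Ioi 0)) :
    IntegrableOn (fun t : ℝ => 2 * inner ℝ (inner ℂ f (NormedSpace.exp ((t : ℂ) • A) g))
      (inner ℂ h (NormedSpace.exp ((t : ℂ) • A) g))) (Set.Ioi 0) := by
  refine (hf.add hh).mono' ?_ (Filter.Eventually.of_forall fun t => ?_)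
  · exact (continuous_const.mul ((continuous_inner_exp_smul A g f).inner
      (continuous_inner_exp_smul A g h))).aestronglyMeasurable
  · simpa [orbitCoeffSq] using abs_two_mul_real_inner_le one_pos
      (inner ℂ f (NormedSpace.exp ((t : ℂ) • A) g)) (inner ℂ h (NormedSpace.exp ((t : ℂ) • A) g))

/-- The Lyapunov equation for the frame operator, in weak form. -/
theorem integral_two_mul_inner_adjoint_orbit (A : H →L[ℂ] H) (g f : H)
    (hf : IntegrableOn (orbitCoeffSq A g f) (Set.Ioi 0))
    (hh : IntegrableOn (orbitCoeffSq A g (A.adjoint f)) (Set.Ioi 0)) :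
    ∫ t in Set.Ioi (0 : ℝ), 2 * inner ℝ (inner ℂ f (NormedSpace.exp ((t : ℂ) • A) g))
      (inner ℂ (A.adjoint f) (NormedSpace.exp ((t : ℂ) • A) g)) = -‖inner ℂ f g‖ ^ 2 := by
  have hd : ∀ t : ℝ, HasDerivAt (orbitCoeffSq A g f)
      (2 * inner ℝ (inner ℂ f (NormedSpace.exp ((t : ℂ) • A) g))
        (inner ℂ (A.adjoint f) (NormedSpace.exp ((t : ℂ) • A) g))) t :=
    fun t => (hasDerivAt_inner_exp_smul A g f t).norm_sq
  have hi := integrableOn_two_mul_inner_orbit A g f _ hf hh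
  -- The coefficient and its derivative are both integrable, so the boundary value at infinity is
  -- zero.
  rw [integral_Ioi_of_hasDerivAt_of_tendsto' (fun t _ => hd t) hi
    (tendsto_zero_of_hasDerivAt_of_integrableOn_Ioi (fun t _ => hd t) hi hf)]
  simp [orbitCoeffSq]

variable {A : H →L[ℂ] H} {g : ι → H} {c C : ℝ}

/-- A quantitative Hautus test: on the orthogonal complement of the generators, `A† - z̄` is
bounded below when `z` is off the imaginary axis. -/
theorem IsOrbitFrame.norm_sq_le (hF : IsOrbitFrame A g c C) (z : ℂ) (f : H)
    (hf : ∀ i, inner ℂ (g i) f = 0) :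
    z.re ^ 2 * (c * ‖f‖ ^ 2) ≤ C * ‖A.adjoint f - (starRingEnd ℂ z) • f‖ ^ 2 := by
  rcases eq_or_ne z.re 0 with hz | hz
  · have h := (Finset.sum_nonneg fun i _ => integral_nonneg fun t =>
      orbitCoeffSq_nonneg A (g i) _ t).trans (hF.upper (A.adjoint f - (starRingEnd ℂ z) • f))
    simpa [hz] using h
  set h := A.adjoint f - (starRingEnd ℂ z) • f with hh
  have hpos : 0 < |z.re| := abs_pos.2 hz
  have key : ∀ i, |z.re| * ∫ t in Set.Ioi 0, orbitCoeffSq A (g i) f t ≤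
      |z.re|⁻¹ * ∫ t in Set.Ioi 0, orbitCoeffSq A (g i) h t := by
    intro i
    have I1 := hF.integrableOn f i
    have I2 := hF.integrableOn h i
    have e1 := integral_two_mul_inner_adjoint_orbit A (g i) f I1 (hF.integrableOn _ i)
    have hz0 : inner ℂ f (g i) = 0 := by rw [← inner_conj_symm, hf i, map_zero]
    have hi := integrableOn_two_mul_inner_orbit A (g i) f h I1 I2
    have e2 : ∀ t : ℝ, 2 * inner ℝ (inner ℂ f (NormedSpace.exp ((t : ℂ) • A) (g i)))
        (inner ℂ (A.adjoint f) (NormedSpace.exp ((t : ℂ) • A) (g i))) =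
        2 * z.re * orbitCoeffSq A (g i) f t +
        2 * inner ℝ (inner ℂ f (NormedSpace.exp ((t : ℂ) • A) (g i)))
          (inner ℂ h (NormedSpace.exp ((t : ℂ) • A) (g i))) := by
      intro t
      have : A.adjoint f = h + (starRingEnd ℂ z) • f := by simp [hh]
      rw [this, inner_add_left, inner_smul_left, Complex.conj_conj, inner_add_right, orbitCoeffSq]
      set u : ℂ := inner ℂ f (NormedSpace.exp ((t : ℂ) • A) (g i))
      have : inner ℝ u (z * u) = z.re * ‖u‖ ^ 2 := by
        rw [Complex.inner, Complex.sq_norm, Complex.normSq_apply]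
        simp
        ring
      rw [this]
      ring
    simp_rw [e2] at e1
    rw [integral_add (I1.const_mul _) hi, integral_const_mul, hz0, norm_zero] at e1
    -- By `e1` the cross integral is `-2 Re z ∫ |⟪f, e^{tA} g⟫|²`, so this bound leaves `|Re z|`
    -- times the latter integral on the left.
    have e3 : |∫ t in Set.Ioi (0 : ℝ),
        2 * inner ℝ (inner ℂ f (NormedSpace.exp ((t : ℂ) • A) (g i)))
          (inner ℂ h (NormedSpace.exp ((t : ℂ) • A) (g i)))| ≤
        |z.re| * (∫ t in Set.Ioi 0, orbitCoeffSq A (g i) f t) +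
        |z.re|⁻¹ * ∫ t in Set.Ioi 0, orbitCoeffSq A (g i) h t := by
      rw [← integral_const_mul, ← integral_const_mul,
        ← integral_add (I1.const_mul _) (I2.const_mul _)]
      refine (abs_integral_le_integral_abs).trans (integral_mono hi.abs
        ((I1.const_mul _).add (I2.const_mul _)) fun t => ?_)
      exact abs_two_mul_real_inner_le hpos _ _
    have e4 : |2 * z.re * ∫ t in Set.Ioi 0, orbitCoeffSq A (g i) f t| =
        2 * |z.re| * ∫ t in Set.Ioi 0, orbitCoeffSq A (g i) f t := by
      rw [abs_mul, abs_mul, abs_two,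
        abs_of_nonneg (integral_nonneg fun t => orbitCoeffSq_nonneg A (g i) f t)]
    have e5 : 2 * z.re * (∫ t in Set.Ioi 0, orbitCoeffSq A (g i) f t) =
        -∫ t in Set.Ioi (0 : ℝ),
        2 * inner ℝ (inner ℂ f (NormedSpace.exp ((t : ℂ) • A) (g i)))
          (inner ℂ h (NormedSpace.exp ((t : ℂ) • A) (g i))) := by linarith
    rw [e5, abs_neg] at e4
    linarith
  have key2 : |z.re| * (c * ‖f‖ ^ 2) ≤ |z.re|⁻¹ * (C * ‖h‖ ^ 2) := by
    calc _ ≤ |z.re| * ∑ i, ∫ t in Set.Ioi 0, orbitCoeffSq A (g i) f t := by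
            gcongr; exact hF.lower f
      _ ≤ |z.re|⁻¹ * ∑ i, ∫ t in Set.Ioi 0, orbitCoeffSq A (g i) h t := by
            rw [Finset.mul_sum, Finset.mul_sum]; exact Finset.sum_le_sum fun i _ => key i
      _ ≤ _ := by gcongr; exact hF.upper h
  rw [← div_eq_inv_mul, le_div_iff₀ hpos] at key2
  rw [← sq_abs]
  linarith

/-- Intertwining passes to powers, hence to the exponential series. It serves functionals given by
eigenvectors of `A†` and projections onto reducing subspaces. -/
theorem exp_apply_of_comp_eq {E F : Type*} [NormedAddCommGroup E] [NormedSpace ℂ E]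
    [CompleteSpace E] [NormedAddCommGroup F] [NormedSpace ℂ F] [CompleteSpace F]
    (A : E →L[ℂ] E) (B : F →L[ℂ] F) (T : E →L[ℂ] F) (h : ∀ x, T (A x) = B (T x)) (x : E) :
    T (NormedSpace.exp A x) = NormedSpace.exp B (T x) := by
  have hp : ∀ n : ℕ, T ((A ^ n) x) = (B ^ n) (T x) := by
    intro n
    induction n with
    | zero => simp
    | succ n ih => rw [pow_succ', pow_succ', mul_apply_eq_comp,
        mul_apply_eq_comp, h, ih]
  have h1 := (NormedSpace.exp_series_hasSum_exp' (𝕂 := ℂ) A).mapL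
    (T.comp (ContinuousLinearMap.apply ℂ E x))
  have h2 := (NormedSpace.exp_series_hasSum_exp' (𝕂 := ℂ) B).mapL
    (ContinuousLinearMap.apply ℂ F (T x))
  refine h1.unique ?_
  convert h2 using 2 with n
  · exact (map_smul T _ _).trans (congrArg _ (hp n))
  · rfl

/-- Eigenvectors of `A†` orthogonal to all generators vanish. -/
theorem IsOrbitFrame.eq_zero_of_adjoint_apply_eq (hF : IsOrbitFrame A g c C) {z : ℂ} {f : H}
    (hAf : A.adjoint f = (starRingEnd ℂ z) • f) (hf : ∀ i, inner ℂ (g i) f = 0) : f = 0 := by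
  have h0 : ∀ i t, orbitCoeffSq A (g i) f t = 0 := by
    intro i t
    have := exp_apply_of_comp_eq ((t : ℂ) • A) (((t : ℂ) * z) • ContinuousLinearMap.id ℂ ℂ)
      (innerSL ℂ f) (fun x => by
        simp [← ContinuousLinearMap.adjoint_inner_left, hAf, inner_smul_left, mul_assoc]) (g i)
    simp only [innerSL_apply_apply] at this
    rw [orbitCoeffSq, this, ← inner_conj_symm, hf i]
    simp
  have := hF.lower f
  simp only [h0, integral_zero, Finset.sum_const_zero] at this
  have h2 : ‖f‖ ^ 2 ≤ 0 := by
    by_contra hcon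
    exact absurd this (not_le.2 (mul_pos hF.lower_pos (not_le.1 hcon)))
  simpa using le_antisymm h2 (sq_nonneg _)

/-- The frame property excludes skew-adjoint generators on nonzero spaces. -/
theorem IsOrbitFrame.eq_zero_of_mem_skewAdjoint (hF : IsOrbitFrame A g c C)
    (hA : A ∈ skewAdjoint (H →L[ℂ] H)) (f : H) : f = 0 := by
  have hstar : ∀ s : ℝ, ‖(NormedSpace.exp ((s : ℂ) • A)).adjoint f‖ = ‖f‖ := by
    intro s
    have hs : ((s : ℂ) • A) ∈ skewAdjoint (H →L[ℂ] H) := by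
      rw [skewAdjoint.mem_iff] at hA ⊢
      simp [star_smul, hA]
    let := NormedAlgebra.restrictScalars ℚ ℂ (H →L[ℂ] H)
    have hu := NormedSpace.exp_mem_unitary_of_mem_skewAdjoint hs
    exact ContinuousLinearMap.norm_map_of_mem_unitary (Unitary.star_mem hu) f
  -- Applying `(e^{sA})†` to `f` shifts time by `s`, so its frame integral is a tail of that of `f`,
  -- while its norm is unchanged.
  have hshift : ∀ (s : ℝ) i, ∫ t in Set.Ioi 0, orbitCoeffSq A (g i)
      ((NormedSpace.exp ((s : ℂ) • A)).adjoint f) t =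
      ∫ t in Set.Ioi s, orbitCoeffSq A (g i) f t := by
    intro s i
    have := (measurePreserving_add_left volume s).setIntegral_preimage_emb
      (measurableEmbedding_addLeft s) (orbitCoeffSq A (g i) f) (Set.Ioi s)
    rw [Set.preimage_const_add_Ioi, sub_self] at this
    rw [← this]
    congr 1 with t
    let := NormedAlgebra.restrictScalars ℚ ℂ (H →L[ℂ] H)
    rw [orbitCoeffSq, orbitCoeffSq, ContinuousLinearMap.adjoint_inner_left,
      ← mul_apply_eq_comp, ← NormedSpace.exp_add_of_commute]
    · simp [add_smul]
    · exact ((Commute.refl A).smul_left _).smul_right _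
  have hlim : Filter.Tendsto (fun s : ℝ => ∑ i, ∫ t in Set.Ioi s, orbitCoeffSq A (g i) f t)
      Filter.atTop (nhds 0) := by
    rw [← Finset.sum_const_zero (s := (Finset.univ : Finset ι))]
    refine tendsto_finsetSum _ fun i _ => ?_
    have h1 := intervalIntegral_tendsto_integral_Ioi 0 (hF.integrableOn f i) Filter.tendsto_id
    have h2 := h1.const_sub (∫ t in Set.Ioi 0, orbitCoeffSq A (g i) f t)
    rw [sub_self] at h2
    refine h2.congr' ?_
    filter_upwards [Filter.eventually_ge_atTop 0] with s hs
    rw [sub_eq_iff_eq_add, id, intervalIntegral.integral_of_le hs, add_comm,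
      ← setIntegral_union Set.Ioc_disjoint_Ioi_same measurableSet_Ioi
        ((hF.integrableOn f i).mono_set Set.Ioc_subset_Ioi_self)
        ((hF.integrableOn f i).mono_set (Set.Ioi_subset_Ioi hs)),
      Set.Ioc_union_Ioi_eq_Ioi hs]
  have hle : c * ‖f‖ ^ 2 ≤ 0 := by
    refine ge_of_tendsto' hlim fun s => ?_
    have := hF.lower ((NormedSpace.exp ((s : ℂ) • A)).adjoint f)
    simpa only [hstar, hshift] using this
  have h2 : ‖f‖ ^ 2 ≤ 0 := by
    by_contra hcon
    exact absurd hle (not_le.2 (mul_pos hF.lower_pos (not_le.1 hcon)))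
  simpa using le_antisymm h2 (sq_nonneg _)

end Orbit

/-! ### Normal operators and existence of eigenvectors -/

section NormalOperators

variable {H : Type*} [NormedAddCommGroup H] [InnerProductSpace ℂ H] [CompleteSpace H]

theorem IsStarNormal.sub_smul_one {A : H →L[ℂ] H} (hA : IsStarNormal A) (z : ℂ) :
    IsStarNormal (A - z • (1 : H →L[ℂ] H)) := by
  rw [isStarNormal_iff]
  have h1 : Commute (star A - (starRingEnd ℂ z) • (1 : H →L[ℂ] H)) (A - z • (1 : H →L[ℂ] H)) := by
    refine Commute.sub_left (Commute.sub_right hA.star_comm_self ?_)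
      ((Commute.one_left _).smul_left _)
    exact (Commute.one_right _).smul_right _
  simpa using h1

theorem IsStarNormal.norm_adjoint_apply_sub {A : H →L[ℂ] H} (hA : IsStarNormal A) (z : ℂ) (f : H) :
    ‖A.adjoint f - (starRingEnd ℂ z) • f‖ = ‖A f - z • f‖ := by
  have h := ContinuousLinearMap.isStarNormal_iff_norm_eq_adjoint.1 (hA.sub_smul_one z) f
  rw [← ContinuousLinearMap.star_eq_adjoint] at h ⊢
  simpa using h.symm

theorem IsStarNormal.adjoint_apply_eq_conj_smul {A : H →L[ℂ] H} (hA : IsStarNormal A) {z : ℂ}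
    {f : H} (hf : A f = z • f) : A.adjoint f = (starRingEnd ℂ z) • f := by
  have h := hA.norm_adjoint_apply_sub z f
  rwa [hf, sub_self, norm_zero, norm_eq_zero, sub_eq_zero] at h

/-- By functional calculus: conjugation and negation agree on the imaginary axis. -/
theorem IsStarNormal.mem_skewAdjoint_of_spectrum {A : H →L[ℂ] H} (hA : IsStarNormal A)
    (h : ∀ z ∈ spectrum ℂ A, z.re = 0) : A ∈ skewAdjoint (H →L[ℂ] H) := by
  rw [skewAdjoint.mem_iff, ← cfc_star_id (R := ℂ) A, ← cfc_neg_id (R := ℂ) A]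
  refine cfc_congr fun z hz => ?_
  apply Complex.ext <;> simp [h z hz]

/-- A normal operator that is injective, and bounded below on a closed subspace of finite
codimension, is invertible. -/
theorem IsStarNormal.isUnit_of_bounded_below {A : H →L[ℂ] H} (hA : IsStarNormal A)
    (hinj : ∀ f, A f = 0 → f = 0) {K : Submodule ℂ H} [K.CoFG] (hK : IsClosed (K : Set H))
    {δ : ℝ} (hδ : 0 < δ) (h : ∀ f ∈ K, δ * ‖f‖ ≤ ‖A f‖) : IsUnit A := by
  rw [ContinuousLinearMap.isUnit_iff_bijective]
  refine ⟨(injective_iff_map_eq_zero A).2 hinj, ?_⟩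
  have : CompleteSpace K := hK.completeSpace_coe
  have hanti : AntilipschitzWith (Real.toNNReal δ⁻¹) (A.comp K.subtypeL) := by
    refine ContinuousLinearMap.antilipschitz_of_bound _ fun x => ?_
    rw [Real.coe_toNNReal _ (inv_nonneg.2 hδ.le), inv_mul_eq_div, le_div_iff₀ hδ, mul_comm]
    exact h x x.2
  have hclosed : IsClosed (K.map (A : H →ₗ[ℂ] H) : Set H) := by
    have := hanti.isClosed_range (A.comp K.subtypeL).uniformContinuous
    convert this using 1
    ext y
    simp
  -- A closed image of a finite-codimensional subspace makes the whole range closed; normality below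
  -- identifies its complement with the kernel, making it dense.
  have hr : IsClosed ((A : H →ₗ[ℂ] H).range : Set H) :=
    LinearMap.isClosed_range_of_isClosed_map_of_finiteDimensional_quotient hclosed
  have horth : (A : H →ₗ[ℂ] H).rangeᗮ = ⊥ := by
    have := ContinuousLinearMap.IsStarNormal.orthogonal_range hA
    refine this.trans ?_
    rw [Submodule.eq_bot_iff]
    exact fun f hf => hinj f hf
  have : CompleteSpace (A : H →ₗ[ℂ] H).range := hr.completeSpace_coe
  have htop := (Submodule.orthogonal_eq_bot_iff).1 horth
  exact LinearMap.range_eq_top.1 htop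

variable {ι : Type*} [Fintype ι] {A : H →L[ℂ] H} {g : ι → H} {c C : ℝ}

/-- The coefficient map `f ↦ (⟪g i, f⟫)ᵢ`. -/
noncomputable def innerFamily (g : ι → H) : H →L[ℂ] (ι → ℂ) :=
  ContinuousLinearMap.pi fun i => innerSL ℂ (g i)

theorem IsOrbitFrame.exists_eigenvector [Nontrivial H] (hF : IsOrbitFrame A g c C)
    (hA : IsStarNormal A) : ∃ (z : ℂ) (f : H), f ≠ 0 ∧ A f = z • f := by
  by_contra! hcon
  obtain ⟨f₀, hf₀⟩ := exists_ne (0 : H)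
  have hspec : ∃ z ∈ spectrum ℂ A, z.re ≠ 0 := by
    by_contra! hre
    exact hf₀ (hF.eq_zero_of_mem_skewAdjoint (hA.mem_skewAdjoint_of_spectrum hre) f₀)
  obtain ⟨z, hz, hre⟩ := hspec
  have hC : 0 < C := by
    have h1 := (hF.lower f₀).trans (hF.upper f₀)
    have h2 : 0 < ‖f₀‖ ^ 2 := by positivity
    exact hF.lower_pos.trans_le (le_of_mul_le_mul_right h1 h2)
  have hc := hF.lower_pos
  -- The lower bound of `norm_sq_le` after division by `C`; positivity uses `Re z ≠ 0`.
  have hδ : 0 < Real.sqrt (z.re ^ 2 * c / C) := Real.sqrt_pos.2 (by positivity)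
  have : (innerFamily g : H →ₗ[ℂ] (ι → ℂ)).ker.CoFG := Submodule.CoFG.ker _
  have hU : IsUnit (A - z • (1 : H →L[ℂ] H)) := by
    refine (hA.sub_smul_one z).isUnit_of_bounded_below (fun f hf => ?_)
      (K := (innerFamily g : H →ₗ[ℂ] (ι → ℂ)).ker)
      (ContinuousLinearMap.isClosed_ker (innerFamily g)) hδ fun f hf => ?_
    · by_contra hne
      exact hcon z f hne (by simpa [sub_eq_zero] using hf)
    · have hf' : ∀ i, inner ℂ (g i) f = 0 := fun i => congrFun hf i
      have h1 := hF.norm_sq_le z f hf'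
      rw [hA.norm_adjoint_apply_sub] at h1
      have h2 : z.re ^ 2 * c / C * ‖f‖ ^ 2 ≤ ‖A f - z • f‖ ^ 2 := by
        rw [div_mul_eq_mul_div, div_le_iff₀ hC]
        linarith
      have h3 := Real.sqrt_le_sqrt h2
      rw [Real.sqrt_mul (by positivity), Real.sqrt_sq (norm_nonneg _),
        Real.sqrt_sq (norm_nonneg _)] at h3
      simpa using h3
  rw [spectrum.mem_iff, Algebra.algebraMap_eq_smul_one, ← IsUnit.neg_iff, neg_sub] at hz
  exact hz hU

/-! ### Reducing subspaces -/

/-- The restriction of an operator to an invariant subspace. -/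
noncomputable def ContinuousLinearMap.restrictInvariant (A : H →L[ℂ] H) (N : Submodule ℂ H)
    (hN : ∀ x ∈ N, A x ∈ N) : N →L[ℂ] N :=
  (A.comp N.subtypeL).codRestrict N fun x => hN x x.2

theorem ContinuousLinearMap.adjoint_restrictInvariant (A : H →L[ℂ] H) (N : Submodule ℂ H)
    [CompleteSpace N] (hN : ∀ x ∈ N, A x ∈ N) (hN' : ∀ x ∈ N, A.adjoint x ∈ N) :
    (A.restrictInvariant N hN).adjoint = A.adjoint.restrictInvariant N hN' := by
  symm
  rw [ContinuousLinearMap.eq_adjoint_iff]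
  intro x y
  exact ContinuousLinearMap.adjoint_inner_left A (y : H) (x : H)

theorem IsStarNormal.restrictInvariant (hA : IsStarNormal A) (N : Submodule ℂ H)
    [CompleteSpace N] (hN : ∀ x ∈ N, A x ∈ N) (hN' : ∀ x ∈ N, A.adjoint x ∈ N) :
    IsStarNormal (A.restrictInvariant N hN) := by
  rw [ContinuousLinearMap.isStarNormal_iff_norm_eq_adjoint,
    ContinuousLinearMap.adjoint_restrictInvariant A N hN hN']
  exact fun v => ContinuousLinearMap.isStarNormal_iff_norm_eq_adjoint.1 hA v

/-- The frame property passes to reducing subspaces by projecting the generators. -/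
theorem IsOrbitFrame.restrictInvariant (hF : IsOrbitFrame A g c C) (N : Submodule ℂ H)
    [CompleteSpace N] (hN : ∀ x ∈ N, A x ∈ N) (hN' : ∀ x ∈ N, A.adjoint x ∈ N) :
    IsOrbitFrame (A.restrictInvariant N hN) (fun i => N.orthogonalProjectionOnto (g i)) c C := by
  have hcomm : ∀ x, N.orthogonalProjectionOnto (A x) =
      A.restrictInvariant N hN (N.orthogonalProjectionOnto x) := by
    intro x
    refine ext_inner_left ℂ fun v => ?_
    rw [← ContinuousLinearMap.adjoint_inner_left (A.restrictInvariant N hN),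
      ContinuousLinearMap.adjoint_restrictInvariant A N hN hN',
      Submodule.inner_orthogonalProjectionOnto_eq_of_mem_left,
      Submodule.inner_orthogonalProjectionOnto_eq_of_mem_left,
      ← ContinuousLinearMap.adjoint_inner_left]
    rfl
  -- Vectors of `N` do not see the discarded components, so both frame bounds carry over unchanged.
  have hq : ∀ (f : N) i, orbitCoeffSq (A.restrictInvariant N hN)
      (N.orthogonalProjectionOnto (g i)) f = orbitCoeffSq A (g i) f := by
    intro f i
    ext t
    rw [orbitCoeffSq, orbitCoeffSq, ← exp_apply_of_comp_eq ((t : ℂ) • A) _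
      N.orthogonalProjectionOnto (fun x => by simp [hcomm]),
      Submodule.inner_orthogonalProjectionOnto_eq_of_mem_left]
  refine ⟨hF.lower_pos, fun f i => ?_, fun f => ?_, fun f => ?_⟩
  · rw [hq]; exact hF.integrableOn _ i
  · simp only [hq]; exact hF.lower f
  · simp only [hq]; exact hF.upper f

/-! ### Eigenspaces: completeness, multiplicity and number -/

theorem IsStarNormal.isOrtho_eigenspace (hA : IsStarNormal A) {z w : ℂ} (hzw : z ≠ w) :
    Module.End.eigenspace (A : H →ₗ[ℂ] H) z ⟂ Module.End.eigenspace (A : H →ₗ[ℂ] H) w := by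
  rw [Submodule.isOrtho_iff_inner_eq]
  intro x hx y hy
  rw [Module.End.mem_eigenspace_iff, ContinuousLinearMap.coe_coe] at hx hy
  have h := ContinuousLinearMap.adjoint_inner_left A y x
  rw [hA.adjoint_apply_eq_conj_smul hx, hy, inner_smul_left, inner_smul_right,
    Complex.conj_conj] at h
  exact (mul_eq_mul_right_iff.1 h).resolve_left hzw

theorem ContinuousLinearMap.apply_mem_orthogonal_of_adjoint (B : H →L[ℂ] H) (M : Submodule ℂ H)
    (h : ∀ x ∈ M, B.adjoint x ∈ M) : ∀ x ∈ Mᗮ, B x ∈ Mᗮ := by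
  intro x hx
  rw [Submodule.mem_orthogonal] at hx ⊢
  intro u hu
  rw [← ContinuousLinearMap.adjoint_inner_left]
  exact hx _ (h u hu)

/-- The complement reduces `A`; were it nonzero, it would contain an eigenvector, which already lies
in the span of the eigenspaces. -/
theorem IsOrbitFrame.orthogonal_iSup_eigenspace (hF : IsOrbitFrame A g c C)
    (hA : IsStarNormal A) : (⨆ z, Module.End.eigenspace (A : H →ₗ[ℂ] H) z)ᗮ = ⊥ := by
  set M := ⨆ z, Module.End.eigenspace (A : H →ₗ[ℂ] H) z with hM
  have hle : ∀ z, Module.End.eigenspace (A : H →ₗ[ℂ] H) z ≤ M := le_iSup _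
  have hMA : ∀ x ∈ M, A x ∈ M := by
    have : M ≤ M.comap (A : H →ₗ[ℂ] H) := by
      refine iSup_le fun z x hx => ?_
      rw [Submodule.mem_comap, Module.End.mem_eigenspace_iff.1 hx]
      exact M.smul_mem _ (hle z hx)
    exact this
  have hMA' : ∀ x ∈ M, A.adjoint x ∈ M := by
    have : M ≤ M.comap (A.adjoint : H →ₗ[ℂ] H) := by
      refine iSup_le fun z x hx => ?_
      rw [Submodule.mem_comap, ContinuousLinearMap.coe_coe,
        hA.adjoint_apply_eq_conj_smul (Module.End.mem_eigenspace_iff.1 hx)]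
      exact M.smul_mem _ (hle z hx)
    exact this
  have hN := A.apply_mem_orthogonal_of_adjoint M hMA'
  have hN' := A.adjoint.apply_mem_orthogonal_of_adjoint M (by simpa using hMA)
  by_contra hne
  have : Nontrivial Mᗮ := Submodule.nontrivial_iff_ne_bot.2 hne
  obtain ⟨z, f, hf, hzf⟩ := (hF.restrictInvariant Mᗮ hN hN').exists_eigenvector
    (hA.restrictInvariant Mᗮ hN hN')
  have hfM : (f : H) ∈ M := hle z (Module.End.mem_eigenspace_iff.2 (congrArg Subtype.val hzf))
  have := Submodule.inner_right_of_mem_orthogonal hfM f.2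
  exact hf (by simpa using this)

theorem IsOrbitFrame.eq_zero_of_mem_eigenspace (hF : IsOrbitFrame A g c C) (hA : IsStarNormal A)
    {z : ℂ} {f : H} (hf : f ∈ Module.End.eigenspace (A : H →ₗ[ℂ] H) z)
    (hg : innerFamily g f = 0) : f = 0 :=
  hF.eq_zero_of_adjoint_apply_eq
    (hA.adjoint_apply_eq_conj_smul (Module.End.mem_eigenspace_iff.1 hf)) fun i => congrFun hg i

theorem IsOrbitFrame.injective_innerFamily_eigenspace (hF : IsOrbitFrame A g c C)
    (hA : IsStarNormal A) (z : ℂ) : Function.Injective ((innerFamily g : H →ₗ[ℂ] (ι → ℂ)).comp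
      (Module.End.eigenspace (A : H →ₗ[ℂ] H) z).subtype) := by
  rw [injective_iff_map_eq_zero]
  exact fun f hf => Subtype.ext (hF.eq_zero_of_mem_eigenspace hA f.2 hf)

theorem IsOrbitFrame.finiteDimensional_eigenspace (hF : IsOrbitFrame A g c C)
    (hA : IsStarNormal A) (z : ℂ) :
    FiniteDimensional ℂ (Module.End.eigenspace (A : H →ₗ[ℂ] H) z) :=
  FiniteDimensional.of_injective _ (hF.injective_innerFamily_eigenspace hA z)

/-- Unit eigenvectors for distinct eigenvalues are orthonormal. By Bessel each generator pairs
nontrivially with only countably many, yet every eigenvector pairs nontrivially with some generator.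
-/
theorem IsOrbitFrame.countable_eigenvalues (hF : IsOrbitFrame A g c C) (hA : IsStarNormal A) :
    {z | Module.End.eigenspace (A : H →ₗ[ℂ] H) z ≠ ⊥}.Countable := by
  set S := {z | Module.End.eigenspace (A : H →ₗ[ℂ] H) z ≠ ⊥}
  have hex : ∀ z : S, ∃ f ∈ Module.End.eigenspace (A : H →ₗ[ℂ] H) (z : ℂ), ‖f‖ = 1 := by
    intro z
    obtain ⟨f, hf, hne⟩ := Submodule.exists_mem_ne_zero_of_ne_bot z.2
    exact ⟨((‖f‖⁻¹ : ℝ) : ℂ) • f, Submodule.smul_mem _ _ hf, by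
      simp [norm_smul, hne]⟩
  choose v hv hv1 using hex
  have hon : Orthonormal ℂ v := ⟨hv1, fun z w hzw =>
    Submodule.isOrtho_iff_inner_eq.1 (hA.isOrtho_eigenspace fun h => hzw (Subtype.ext h))
      _ (hv z) _ (hv w)⟩
  have hcount : (⋃ i, Function.support fun z => ‖inner ℂ (v z) (g i)‖ ^ 2).Countable :=
    Set.countable_iUnion fun i => (hon.inner_products_summable (g i)).countable_support
  have huniv : (⋃ i, Function.support fun z => ‖inner ℂ (v z) (g i)‖ ^ 2) = Set.univ := by
    refine Set.eq_univ_of_forall fun z => ?_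
    by_contra hcon
    have h0 : innerFamily g (v z) = 0 := by
      funext i
      have : inner ℂ (v z) (g i) = 0 := by
        simp only [Set.mem_iUnion, not_exists, Function.notMem_support] at hcon
        simpa using hcon i
      exact (inner_eq_zero_symm).1 this
    have h1 := hv1 z
    rw [hF.eq_zero_of_mem_eigenspace hA (hv z) h0, norm_zero] at h1
    exact zero_ne_one h1
  rw [huniv, Set.countable_univ_iff] at hcount
  exact hcount

/-- Finitely many finite-dimensional eigenspaces have a closed span, which would be all of `H`. -/
theorem IsOrbitFrame.infinite_eigenvalues (hF : IsOrbitFrame A g c C) (hA : IsStarNormal A)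
    (hH : ¬ FiniteDimensional ℂ H) :
    {z | Module.End.eigenspace (A : H →ₗ[ℂ] H) z ≠ ⊥}.Infinite := by
  intro hfin
  apply hH
  have := hfin.to_subtype
  have hfd := hF.finiteDimensional_eigenspace hA
  have heq : (⨆ z, Module.End.eigenspace (A : H →ₗ[ℂ] H) z) =
      ⨆ z : {z | Module.End.eigenspace (A : H →ₗ[ℂ] H) z ≠ ⊥},
        Module.End.eigenspace (A : H →ₗ[ℂ] H) (z : ℂ) := by
    refine le_antisymm (iSup_le fun z => ?_) (iSup_le fun z => le_iSup _ (z : ℂ))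
    rcases eq_or_ne (Module.End.eigenspace (A : H →ₗ[ℂ] H) z) ⊥ with h | h
    · rw [h]; exact bot_le
    · exact le_iSup (fun z : {z | Module.End.eigenspace (A : H →ₗ[ℂ] H) z ≠ ⊥} =>
        Module.End.eigenspace (A : H →ₗ[ℂ] H) (z : ℂ)) ⟨z, h⟩
  have h0 := hF.orthogonal_iSup_eigenspace hA
  rw [heq] at h0
  have htop := Submodule.orthogonal_eq_bot_iff.1 h0
  have : FiniteDimensional ℂ (⊤ : Submodule ℂ H) := by
    rw [← htop]; infer_instance
  exact Module.Finite.equiv (Submodule.topEquiv (R := ℂ) (M := H))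

end NormalOperators

/-! ### Assembling the spectral decomposition -/

theorem IsHilbertSum.hasSum_starProjection {H ι : Type*} [NormedAddCommGroup H]
    [InnerProductSpace ℂ H] [CompleteSpace H] {F : ι → Submodule ℂ H}
    [∀ i, (F i).HasOrthogonalProjection]
    (hF : IsHilbertSum ℂ (fun i => F i) fun i => (F i).subtypeₗᵢ) (x : H) :
    HasSum (fun i => (F i).starProjection x) x := by
  have h := hF.hasSum_linearIsometryEquiv_symm (hF.linearIsometryEquiv x)
  rw [LinearIsometryEquiv.symm_apply_apply] at h
  convert h using 2 with i
  -- Projecting the expansion onto `F i` isolates its `i`-th term.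
  have h1 := h.mapL (F i).starProjection
  refine h1.unique ?_
  convert hasSum_single i fun j hj => ?_ using 1
  · exact ((F i).starProjection_eq_self_iff.2 (Subtype.property _)).symm
  · rw [Submodule.starProjection_apply_eq_zero_iff, Submodule.mem_orthogonal]
    intro u hu
    exact hF.OrthogonalFamily hj.symm ⟨u, hu⟩ _

theorem IsSemicontinuousFrame.exists_isOrbitFrame {H : Type*} [NormedAddCommGroup H]
    [InnerProductSpace ℂ H] [CompleteSpace H] {A : H →L[ℂ] H} {G : Set H} [Fintype G]
    (h : IsSemicontinuousFrame A G (Set.Ici 0)) :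
    ∃ c C, IsOrbitFrame A (fun x : G => (x : H)) c C := by
  obtain ⟨c, C, hc, hC, h⟩ := h
  have h' : ∀ f : H, ENNReal.ofReal (c * ‖f‖ ^ 2) ≤
        ∑ x : G, ∫⁻ t in Set.Ioi (0 : ℝ), ENNReal.ofReal (orbitCoeffSq A x f t) ∧
      ∑ x : G, ∫⁻ t in Set.Ioi (0 : ℝ), ENNReal.ofReal (orbitCoeffSq A x f t) ≤
        ENNReal.ofReal (C * ‖f‖ ^ 2) := by
    intro f
    have := h f
    rwa [tsum_fintype, Measure.restrict_congr_set Ioi_ae_eq_Ici.symm] at this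
  -- The finite upper bound makes every integral finite, so passing to real integrals loses nothing.
  have hfin : ∀ f, ∀ x ∈ (Finset.univ : Finset G),
      ∫⁻ t in Set.Ioi (0 : ℝ), ENNReal.ofReal (orbitCoeffSq A x f t) ≠ ∞ :=
    fun f => ENNReal.sum_ne_top.1 (ne_top_of_le_ne_top ENNReal.ofReal_ne_top (h' f).2)
  have hint : ∀ f (x : G), IntegrableOn (orbitCoeffSq A x f) (Set.Ioi 0) := by
    intro f x
    refine ⟨(continuous_orbitCoeffSq A x f).aestronglyMeasurable, ?_⟩
    rw [hasFiniteIntegral_iff_ofReal (Filter.Eventually.of_forall (orbitCoeffSq_nonneg A x f))]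
    exact lt_top_iff_ne_top.2 (hfin f x (Finset.mem_univ x))
  have hnonneg : ∀ f (x : G), 0 ≤ ∫ t in Set.Ioi (0 : ℝ), orbitCoeffSq A x f t :=
    fun f x => integral_nonneg (orbitCoeffSq_nonneg A x f)
  have hsum : ∀ f, ∑ x : G, ∫⁻ t in Set.Ioi (0 : ℝ), ENNReal.ofReal (orbitCoeffSq A x f t) =
      ENNReal.ofReal (∑ x : G, ∫ t in Set.Ioi (0 : ℝ), orbitCoeffSq A x f t) := by
    intro f
    rw [ENNReal.ofReal_sum_of_nonneg fun x _ => hnonneg f x]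
    exact Finset.sum_congr rfl fun x _ => (ofReal_integral_eq_lintegral_ofReal (hint f x)
      (Filter.Eventually.of_forall (orbitCoeffSq_nonneg A x f))).symm
  refine ⟨c, C, hc, hint, fun f => ?_, fun f => ?_⟩
  · have := (h' f).1
    rw [hsum, ENNReal.ofReal_le_ofReal_iff (Finset.sum_nonneg fun x _ => hnonneg f x)] at this
    exact this
  · have := (h' f).2
    rw [hsum, ENNReal.ofReal_le_ofReal_iff (by positivity)] at this
    exact this

theorem mainTheorem9 {H : Type*} [NormedAddCommGroup H] [InnerProductSpace ℂ H]
    [CompleteSpace H] (hH : ¬ FiniteDimensional ℂ H)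
    (A : H →L[ℂ] H) (hA : IsStarNormal A)
    (G : Set H) (hG : G.Finite)
    (hframe : IsSemicontinuousFrame A G (Set.Ici 0)) :
    (∃ (l : ℕ → ℂ) (P : ℕ → H →L[ℂ] H),
      Function.Injective l ∧
      (∀ j, IsStarProjection (P j)) ∧
      (∀ j, P j ≠ 0) ∧
      (∀ i j, i ≠ j → P i * P j = 0) ∧
      (∀ x : H, HasSum (fun j => P j x) x) ∧
      (∀ x : H, HasSum (fun j => (-l j) • P j x) (A x)) ∧
      (∀ j, Module.rank ℂ (P j : H →ₗ[ℂ] H).range ≤ (G.ncard : Cardinal))) ∧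
    (∀ z : ℂ, Module.rank ℂ (Module.End.eigenspace (A : H →ₗ[ℂ] H) z) ≤
      (G.ncard : Cardinal)) := by
  have : Fintype G := hG.fintype
  obtain ⟨c, C, hF⟩ := hframe.exists_isOrbitFrame
  have hrank : ∀ z : ℂ, Module.rank ℂ (Module.End.eigenspace (A : H →ₗ[ℂ] H) z) ≤
      (G.ncard : Cardinal) := by
    intro z
    have h := LinearMap.rank_le_of_injective _ (hF.injective_innerFamily_eigenspace hA z)
    rwa [rank_fun', ← Nat.card_eq_fintype_card, Nat.card_coe_set_eq] at h
  refine ⟨?_, hrank⟩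
  have : Countable {z | Module.End.eigenspace (A : H →ₗ[ℂ] H) z ≠ ⊥} :=
    (hF.countable_eigenvalues hA).to_subtype
  have : Infinite {z | Module.End.eigenspace (A : H →ₗ[ℂ] H) z ≠ ⊥} :=
    (hF.infinite_eigenvalues hA hH).to_subtype
  obtain ⟨_⟩ := nonempty_denumerable {z | Module.End.eigenspace (A : H →ₗ[ℂ] H) z ≠ ⊥}
  let e := (Denumerable.eqv {z | Module.End.eigenspace (A : H →ₗ[ℂ] H) z ≠ ⊥}).symm
  let E : ℕ → Submodule ℂ H := fun j => Module.End.eigenspace (A : H →ₗ[ℂ] H) (e j : ℂ)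
  have hfd : ∀ j, FiniteDimensional ℂ (E j) := fun j => hF.finiteDimensional_eigenspace hA _
  have hne : ∀ {i j}, i ≠ j → (e i : ℂ) ≠ e j := fun hij h => hij (e.injective (Subtype.ext h))
  have hortho : ∀ {i j}, i ≠ j → E i ⟂ E j := fun hij => hA.isOrtho_eigenspace (hne hij)
  have hsup : (⨆ z, Module.End.eigenspace (A : H →ₗ[ℂ] H) z) ≤ ⨆ j, E j := by
    refine iSup_le fun z => ?_
    rcases eq_or_ne (Module.End.eigenspace (A : H →ₗ[ℂ] H) z) ⊥ with h | h
    · rw [h]; exact bot_le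
    · have := le_iSup E (e.symm ⟨z, h⟩)
      simpa [E] using this
  have hsum : IsHilbertSum ℂ (fun j => E j) fun j => (E j).subtypeₗᵢ := by
    refine IsHilbertSum.mkInternal (F := E)
      (OrthogonalFamily.of_pairwise fun i j hij => hortho hij) ?_
    rw [top_le_iff, ← Submodule.orthogonal_eq_bot_iff, Submodule.orthogonal_closure, eq_bot_iff,
      ← hF.orthogonal_iSup_eigenspace hA]
    exact Submodule.orthogonal_le hsup
  have hrange : ∀ j, ((E j).starProjection : H →ₗ[ℂ] H).range = E j :=
    fun j => (E j).range_starProjection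
  -- The eigenvalues are `-λ_j`, hence the sign in the witness.
  refine ⟨fun j => -(e j : ℂ), fun j => (E j).starProjection, fun i j hij => ?_, fun j =>
    isStarProjection_starProjection, fun j hj => ?_, fun i j hij => ?_,
    hsum.hasSum_starProjection, fun x => ?_, fun j => ?_⟩
  · exact e.injective (Subtype.ext (neg_injective hij))
  · refine (e j).2 ?_
    have := hrange j
    rw [show (E j).starProjection = 0 from hj] at this
    simpa [E] using this.symm
  · ext x
    refine (Submodule.starProjection_apply_eq_zero_iff _).2 ?_
    exact (hortho hij).symm ((E j).starProjection_apply_mem x)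
  · have h := (hsum.hasSum_starProjection x).mapL A
    convert h using 2 with j
    rw [neg_neg]
    exact (Module.End.mem_eigenspace_iff.1 ((E j).starProjection_apply_mem x)).symm
  · rw [hrange]
    exact hrank _
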